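/- Fix a Grothendieck universe $\mathfrak U$ ("small" means $\mathfrak U$-small). Let $\mathcal C$ be a category and $J$ a Grothendieck topology on $\mathcal C$. **Notions.** * A collection $\mathcal T$ of morphisms of $\mathcal C$ is *semi-localizing* if it contains all identities, is closed under composition, and for every diagram $Y_1\xrightarrow{f_1}X\xleftarrow{f_2}Y_2$ with $f_1\in\mathcal T$ there are $g_1:Z\to Y_1$ and $g_2:Z\to Y_2$ with $g_2\in\mathcal T$ and $f_1g_1=f_2g_2$. The topology $J$ is an *$A$-topology* if there is a semi-localizing $\mathcal T$ such that, for every $X$, a sieve on $X$ is $J$-covering if and only if it contains a morphism of $\mathcal T$. * $\mathcal T(J)$ is the collection of morphisms $f:Y\to X$ such that the sieve of all morphisms to $X$ that factor through $f$ is $J$-covering. $\mathcal C(\mathcal T(J))$ is the subcategory of $\mathcal C$ with all objects of $\mathcal C$ and with the morphisms belonging to $\mathcal T(J)$. * For a collection $\mathcal T$ of morphisms, $\widehat{\mathcal T}$ is the collection of morphisms $f$ such that $f\circ g\in\mathcal T$ for some morphism $g$. * A morphism $f:Y\to X$ is a *Galois covering* if there are a group $G$ and a homomorphism $\rho:G\to\operatorname{Aut}_X(Y)$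 such that for every object $Z$ the group $G$, acting by composition with $\rho(g)$, acts freely on $\operatorname{Hom}(Z,Y)$, and the map $G\backslash\operatorname{Hom}(Z,Y)\to\operatorname{Hom}(Z,X)$ induced by composition with $f$ is injective. $\mathcal T$ *has enough Galois coverings* if $\widehat{\mathcal T'}=\widehat{\mathcal T}$, where $\mathcal T'$ is the collection of the Galois coverings belonging to $\mathcal T$. * A category is *$\Lambda$-connected* if for any two objects $X,Y$ there are an object $Z$ and morphisms $Z\to X$, $Z\to Y$. * $(\mathcal C,J)$ is a *$Y$-site* if every morphism of $\mathcal C$ is an epimorphism; $J$ is an $A$-topology; for all composable $Z\xrightarrow{g}Y\xrightarrow{f}X$ one has $f\circ g\in\mathcal T(J)$ if and only if $f,g\in\mathcal T(J)$; $\mathcal C$ is essentially small; $\mathcal C(\mathcal T(J))$ is $\Lambda$-connected; and $\mathcal T(J)$ has enough Galois coverings. * A *grid* of a $Y$-site $(\mathcal C,J)$ is a pair $(\mathcal C_0,\iota_0)$ of a small partially ordered set $\mathcal C_0$, regarded as a category with a (unique) morphism $x\to y$ exactly when $x\le y$, and a functor $\iota_0:\mathcal C_0\to\mathcal C$ such that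 (1) $\mathcal C_0$ is $\Lambda$-connected; (2) every object of $\mathcal C$ is isomorphic to $\iota_0(X)$ for some *edge object* $X$ of $\mathcal C_0$, i.e. an object $X$ such that $\iota_0(f)\in\mathcal T(J)$ for every morphism $f$ of $\mathcal C_0$ with target $X$; (3) for every object $X$ of $\mathcal C_0$ and every $f:Y\to\iota_0(X)$ in $\mathcal T(J)$ there are a morphism $f':Y'\to X$ in $\mathcal C_0$ and an isomorphism $\alpha:Y\to\iota_0(Y')$ with $f=\iota_0(f')\circ\alpha$; (4) for every object $X$ of $\mathcal C_0$ the functor of undercategories $\mathcal C_{0,X/}\to\mathcal C_{\iota_0(X)/}$ induced by $\iota_0$ is an equivalence of categories. **Proposition.** Let $(\mathcal C,J)$ be a $Y$-site. Suppose that there is an object $X_0$ of $\mathcal C(\mathcal T(J))$ such that the overcategory $\mathcal D=\mathcal C(\mathcal T(J))_{/X_0}$ satisfies at least one of the following two conditions: 1. for any objects $X,Y$ of $\mathcal D$ the set $\operatorname{Hom}_{\mathcal D}(X,Y)$ is finite; 2. there is an at most countable set $S$ of objects of $\mathcal D$ such that every object of $\mathcal D$ receives a morphism from an object belonging to $S$.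 Then there exists a grid of $(\mathcal C,J)$. -/

import Mathlib

open CategoryTheory

universe w v u

namespace YSite

section SemiLocalizing

variable {C : Type u} [Category.{v} C]

/-- A collection of morphisms containing the identities, closed under composition and satisfying
the right Ore condition. -/
structure IsSemiLocalizing (T : MorphismProperty C) : Prop where
  id_mem : ∀ X : C, T (𝟙 X)
  comp_mem : ∀ {X Y Z : C} (g : Z ⟶ Y) (f : Y ⟶ X), T g → T f → T (g ≫ f)
  ore : ∀ {X Y₁ Y₂ : C} (f₁ : Y₁ ⟶ X) (f₂ : Y₂ ⟶ X), T f₁ →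
    ∃ (Z : C) (g₁ : Z ⟶ Y₁) (g₂ : Z ⟶ Y₂), T g₂ ∧ g₁ ≫ f₁ = g₂ ≫ f₂

/-- The sieves on `X` that contain a morphism belonging to `T`. -/
def coveringSieves (T : MorphismProperty C) (X : C) : Set (Sieve X) :=
  {R | ∃ (Y : C) (f : Y ⟶ X), R f ∧ T f}

/-- The morphisms `f` such that `f ∘ g` belongs to `T` for some morphism `g`. -/
def hat (T : MorphismProperty C) : MorphismProperty C :=
  fun Y _ f => ∃ (Z : C) (g : Z ⟶ Y), T (g ≫ f)

/-- `J` is an `A`-topology: it is the topology given by a semi-localizing collection. -/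
def IsATopology (J : GrothendieckTopology C) : Prop :=
  ∃ T : MorphismProperty C, IsSemiLocalizing T ∧ ∀ X : C, J X = coveringSieves T X

/-- The collection `𝒯(J)` of the morphisms `f : Y ⟶ X` such that the sieve of all the morphisms
that factor through `f` is a covering sieve. -/
def coverMor (J : GrothendieckTopology C) : MorphismProperty C :=
  fun _ X f => Sieve.generate (Presieve.singleton f) ∈ J X

instance coverMor_isMultiplicative (J : GrothendieckTopology C) :
    (coverMor J).IsMultiplicative where
  id_mem X := by
    have h : Sieve.generate (Presieve.singleton (𝟙 X)) = ⊤ := by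
      rw [← Sieve.id_mem_iff_eq_top]
      exact Sieve.le_generate _ _ _ (Presieve.singleton_self _)
    change Sieve.generate (Presieve.singleton (𝟙 X)) ∈ J X
    rw [h]
    exact J.top_mem X
  comp_mem {Z Y X} g f hg hf := by
    change Sieve.generate (Presieve.singleton (g ≫ f)) ∈ J X
    refine J.transitive hf _ ?_
    rintro W _ ⟨_, k, _, ⟨⟩, rfl⟩
    refine J.superset_covering ?_ (J.pullback_stable k hg)
    rintro V l ⟨_, m, _, ⟨⟩, hm⟩
    exact ⟨_, m, _, Presieve.singleton_self _, by rw [← Category.assoc, hm, Category.assoc]⟩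

/-- The category `𝒞(𝒯(J))`: the objects of `C`, with the morphisms that belong to `𝒯(J)`. -/
abbrev CoverCat (J : GrothendieckTopology C) : Type u :=
  WideSubcategory (coverMor J)

end SemiLocalizing

section Galois

/-- A map `φ : S → S'` is a pseudo `G`-torsor: it is `G`-invariant, `G` acts freely on `S`, and
the map from the orbit set to `S'` induced by `φ` is injective. -/
structure IsPseudoTorsor (G : Type*) {S S' : Type*} [Group G] [MulAction G S]
    (φ : S → S') : Prop where
  map_smul : ∀ (g : G) (s : S), φ (g • s) = φ s
  free : ∀ (g : G) (s : S), g • s = s → g = 1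
  orbit : ∀ s t : S, φ s = φ t → MulAction.orbitRel G S s t

variable {C : Type u} [Category.{v} C]

/-- The left action of `G` on `Hom(Z, Y)` by composition with `ρ g ∈ Aut_X(Y)`. -/
abbrev homAction {G : Type*} [Group G] {X Y : C} {f : Y ⟶ X}
    (ρ : G →* Aut (Over.mk f)) (Z : C) : MulAction G (Z ⟶ Y) where
  smul g h := h ≫ (ρ g).hom.left
  one_smul h := by
    change h ≫ (ρ 1).hom.left = h
    rw [map_one]
    exact Category.comp_id h
  mul_smul a b h := by
    change h ≫ (ρ (a * b)).hom.left = (h ≫ (ρ b).hom.left) ≫ (ρ a).hom.left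
    rw [map_mul, Category.assoc]
    rfl

/-- The collection of the Galois coverings of `C`. -/
def galoisCovering (C : Type u) [Category.{v} C] : MorphismProperty C :=
  fun Y X f => ∃ (G : Type v) (_ : Group G) (ρ : G →* Aut (Over.mk f)),
    ∀ Z : C, @IsPseudoTorsor G (Z ⟶ Y) (Z ⟶ X) _ (homAction ρ Z) (fun h => h ≫ f)

/-- `T` has enough Galois coverings: with `T'` the collection of the Galois coverings that belong
to `T`, the collections `hat T'` and `hat T` coincide. -/
def HasEnoughGalois (T : MorphismProperty C) : Prop :=
  hat (T ⊓ galoisCovering C) = hat T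

end Galois

section Sites

/-- Any two objects receive morphisms from a common object. -/
def IsLambdaConnected (D : Type u) [Category.{v} D] : Prop :=
  ∀ X Y : D, ∃ Z : D, Nonempty (Z ⟶ X) ∧ Nonempty (Z ⟶ Y)

variable {C : Type u} [Category.{v} C]

structure IsBSite (J : GrothendieckTopology C) : Prop where
  epi : ∀ {X Y : C} (f : Y ⟶ X), Epi f
  aTopology : IsATopology J
  comp_iff : ∀ {X Y Z : C} (g : Z ⟶ Y) (f : Y ⟶ X),
    coverMor J (g ≫ f) ↔ coverMor J f ∧ coverMor J g

/-- `w` is the universe with respect to which `C` is essentially small. -/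
structure IsYSite (J : GrothendieckTopology C) : Prop extends IsBSite J where
  essentiallySmall : EssentiallySmall.{w} C
  lambdaConnected : IsLambdaConnected (CoverCat J)
  enoughGalois : HasEnoughGalois (coverMor J)

/-- Every hom-set is finite. -/
def CardinalityOne (D : Type u) [Category.{v} D] : Prop :=
  ∀ X Y : D, Finite (X ⟶ Y)

/-- There is an at most countable set of objects such that every object receives a morphism from
a member of it. -/
def CardinalityTwo (D : Type u) [Category.{v} D] : Prop :=
  ∃ S : Set D, S.Countable ∧ ∀ X : D, ∃ Y ∈ S, Nonempty (Y ⟶ X)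

/-- An object `X` of `P` is an edge object if `ι` sends every morphism to `X` into `𝒯(J)`. -/
def IsEdge (J : GrothendieckTopology C) {P : Type w} [PartialOrder P] (ι : P ⥤ C) (X : P) : Prop :=
  ∀ (Y : P) (f : Y ⟶ X), coverMor J (ι.map f)

/-- The poset `P`, regarded as a category with a morphism `x ⟶ y` exactly when `x ≤ y`, and the
functor `ι : P ⥤ C` form a grid of `(C, J)`. -/
structure IsGrid (J : GrothendieckTopology C) {P : Type w} [PartialOrder P] (ι : P ⥤ C) :
    Prop where
  lambdaConnected : IsLambdaConnected P
  exists_edge : ∀ X' : C, ∃ X : P, IsEdge J ι X ∧ Nonempty (ι.obj X ≅ X')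
  exists_lift : ∀ (X : P) (Y : C) (f : Y ⟶ ι.obj X), coverMor J f →
    ∃ (Y' : P) (f' : Y' ⟶ X) (α : Y ≅ ι.obj Y'), f = α.hom ≫ ι.map f'
  under_equiv : ∀ X : P, (Under.post ι : Under X ⥤ Under (ι.obj X)).IsEquivalence

end Sites

end YSite

/-!
A fiber functor `Φ : C ⥤ Type w` gives a grid: its category of elements, projected to `C`. The
evaluation of morphisms at an element of `Φ` is injective, so this category is a preorder, and its
projection is a discrete opfibration, so it induces equivalences of undercategories.

Such a `Φ` is pro-represented by a cofiltered diagram of Galois coverings of `X₀` that lie in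
`𝒯(J)` and eventually dominate every object of `𝒞(𝒯(J))_{/X₀}`. Any two morphisms from an object
over `X₀` to a Galois covering differ by an automorphism of the covering; with the Ore condition
this lifts germs along `𝒯(J)`.

Dominating Galois coverings exist in abundance, and the only difficulty is to choose the transition
morphisms compatibly. On finitely many coverings a choice is induced by a common refinement. When
hom-sets are finite, compactness makes a global choice from these; when countably many objects
dominate, a sequence of refinements needs no further compatibility.
-/

namespace YSite

open GrothendieckTopology (RightOreCondition)

section FiberFunctors

variable {C : Type u} [Category.{v} C]

instance coverMor_respectsIso (J : GrothendieckTopology C) : (coverMor J).RespectsIso :=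
  MorphismProperty.respectsIso_of_isStableUnderComposition fun _ X f (_ : IsIso f) => by
    change Sieve.generate (Presieve.singleton f) ∈ J X
    rw [Sieve.generate_of_singleton_isSplitEpi]
    exact J.top_mem X

theorem IsLambdaConnected.of_equivalence {D E : Type*} [Category D] [Category E]
    (hE : IsLambdaConnected E) (e : D ≌ E) : IsLambdaConnected D := fun X Y => by
  obtain ⟨Z, ⟨f⟩, ⟨g⟩⟩ := hE (e.functor.obj X) (e.functor.obj Y)
  exact ⟨e.inverse.obj Z, ⟨e.inverse.map f ≫ e.unitInv.app X⟩,
    ⟨e.inverse.map g ≫ e.unitInv.app Y⟩⟩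

theorem exists_partialOrder_equivalence (E : Type*) [Category E] [Quiver.IsThin E]
    [EssentiallySmall.{w} E] : ∃ (P : Type w) (_ : PartialOrder P), Nonempty (P ≌ E) := by
  let e := equivSmallModel.{w} E
  have : Quiver.IsThin (SmallModel.{w} E) := fun _ _ =>
    ⟨fun _ _ => e.inverse.map_injective (Subsingleton.elim _ _)⟩
  exact ⟨ThinSkeleton (SmallModel.{w} E), inferInstance,
    ⟨(ThinSkeleton.equivalence _).trans e.symm⟩⟩

/- `CategoryOfElements.π Φ` is a discrete opfibration: a morphism out of `x.1` has a unique lift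
with source `x`. -/
theorem under_post_π_isEquivalence (Φ : C ⥤ Type w) (x : Φ.Elements) :
    (Under.post (CategoryOfElements.π Φ) : Under x ⥤ Under x.1).IsEquivalence where
  faithful := ⟨fun {A B} f g h => by
    ext
    exact congrArg (fun φ => φ.right) h⟩
  full := ⟨fun {A B} f => by
    have hf : A.hom.val ≫ f.right = B.hom.val := Under.w f
    have hval : Φ.map f.right A.right.2 = B.right.2 := by
      rw [← A.hom.2, ← B.hom.2, ← hf]
      exact (Functor.map_comp_apply Φ A.hom.val f.right x.2).symm
    exact ⟨Under.homMk ⟨f.right, hval⟩ (Subtype.ext hf), by ext; rfl⟩⟩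
  essSurj := ⟨fun Z => ⟨Under.mk (Y := Φ.elementsMk Z.right (Φ.map Z.hom x.2)) ⟨Z.hom, rfl⟩,
    ⟨Under.isoMk (Iso.refl _) (Category.comp_id _)⟩⟩⟩

/-- A functor that behaves like the fiber functor of a point of `(C, J)`. The axioms are those that
make the projection from its category of elements to `C` a grid, up to replacing the category of
elements by an equivalent partially ordered set. -/
structure IsFiberFunctor (J : GrothendieckTopology C) (Φ : C ⥤ Type w) : Prop where
  isLambdaConnected : IsLambdaConnected Φ.Elements
  injective_eval : ∀ {X : C} (x : Φ.obj X) (Y : C),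
    Function.Injective fun f : X ⟶ Y => Φ.map f x
  surjective_map : ∀ {X Y : C} (f : Y ⟶ X), coverMor J f → Function.Surjective (Φ.map f)
  exists_edge : ∀ X : C, ∃ x : Φ.obj X, ∀ {Y : C} (f : Y ⟶ X),
    x ∈ Set.range (Φ.map f) → coverMor J f

namespace IsFiberFunctor

variable {J : GrothendieckTopology C} {Φ : C ⥤ Type w}

theorem isThin (hΦ : IsFiberFunctor J Φ) : Quiver.IsThin Φ.Elements := fun x y =>
  ⟨fun f g => Subtype.ext (hΦ.injective_eval x.2 y.1 (f.2.trans g.2.symm))⟩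

theorem isGrid (hΦ : IsFiberFunctor J Φ) {P : Type w} [PartialOrder P] (e : P ≌ Φ.Elements) :
    IsGrid J (e.functor ⋙ CategoryOfElements.π Φ) where
  lambdaConnected := hΦ.isLambdaConnected.of_equivalence e
  exists_edge X := by
    obtain ⟨x, hx⟩ := hΦ.exists_edge X
    let i := e.counitIso.app (Φ.elementsMk X x)
    let j := (CategoryOfElements.π Φ).mapIso i
    refine ⟨e.inverse.obj ⟨X, x⟩, fun Y f => ?_, ⟨j⟩⟩
    let g := e.functor.map f ≫ i.hom
    rw [← (coverMor J).cancel_right_of_respectsIso _ j.hom]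
    exact hx g.1 ⟨_, g.2⟩
  exists_lift X Y f hf := by
    obtain ⟨y, hy⟩ := hΦ.surjective_map f hf (e.functor.obj X).2
    let φ : Φ.elementsMk Y y ⟶ e.functor.obj X := ⟨f, hy⟩
    let i := e.counitIso.app (Φ.elementsMk Y y)
    refine ⟨e.inverse.obj ⟨Y, y⟩, e.functor.preimage (i.hom ≫ φ),
      (CategoryOfElements.π Φ).mapIso i.symm, ?_⟩
    rw [Functor.comp_map, Functor.map_preimage]
    exact congrArg Subtype.val (i.inv_hom_id_assoc φ).symm
  under_equiv X := by
    rw [Under.post_comp]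
    have := under_post_π_isEquivalence Φ (e.functor.obj X)
    infer_instance

theorem exists_isGrid [EssentiallySmall.{w} C] (hΦ : IsFiberFunctor J Φ) :
    ∃ (P : Type w) (_ : PartialOrder P) (ι : P ⥤ C), IsGrid J ι := by
  have := hΦ.isThin
  obtain ⟨P, _, ⟨e⟩⟩ := exists_partialOrder_equivalence.{w} Φ.Elements
  exact ⟨P, _, _, hΦ.isGrid e⟩

end IsFiberFunctor

end FiberFunctors

section ProRepresentable

open Limits Opposite

variable {C : Type u} [Category.{v} C] [LocallySmall.{w} C] {K : Type*} [Category K]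
  [Small.{w} K]

/-- The functor `X ↦ colim_k Hom(U k, X)` pro-represented by `U`, as a functor to `Type w`. -/
noncomputable def proRep (U : K ⥤ C) : C ⥤ Type w :=
  shrinkYoneda.{w} ⋙ (Functor.whiskeringLeft _ _ _).obj U.op ⋙ colim

namespace proRep

variable {U : K ⥤ C}

/-- The element of `colim_k Hom(U k, X)` represented by `u : U k ⟶ X`. -/
noncomputable def germ {k : K} {X : C} (u : U.obj k ⟶ X) : (proRep.{w} U).obj X :=
  colimit.ι (U.op ⋙ shrinkYoneda.{w}.obj X) (op k) (shrinkYonedaObjObjEquiv.symm u)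

theorem exists_germ_eq {X : C} (x : (proRep.{w} U).obj X) :
    ∃ (k : K) (u : U.obj k ⟶ X), germ u = x := by
  obtain ⟨k, u, rfl⟩ := Types.jointly_surjective' x
  exact ⟨k.unop, shrinkYonedaObjObjEquiv u,
    congrArg _ (shrinkYonedaObjObjEquiv.symm_apply_apply u)⟩

theorem map_germ {k : K} {X Y : C} (u : U.obj k ⟶ X) (f : X ⟶ Y) :
    (proRep.{w} U).map f (germ u) = germ (u ≫ f) :=
  (colimit.ι_map_apply _ _ _).trans
    (congrArg _ (shrinkYoneda_map_app_shrinkYonedaObjObjEquiv_symm _ _))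

theorem germ_eq_germ_iff [IsCofiltered K] {k l : K} {X : C} (u : U.obj k ⟶ X)
    (v : U.obj l ⟶ X) : (germ u : (proRep.{w} U).obj X) = germ v ↔
      ∃ (j : K) (a : j ⟶ k) (b : j ⟶ l), U.map a ≫ u = U.map b ≫ v := by
  have map_symm {i j : K} (a : j ⟶ i) (t : U.obj i ⟶ X) :
      (U.op ⋙ shrinkYoneda.{w}.obj X).map a.op (shrinkYonedaObjObjEquiv.symm t) =
        shrinkYonedaObjObjEquiv.symm (U.map a ≫ t) :=
    shrinkYoneda_obj_map_shrinkYonedaObjObjEquiv_symm _ _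
  refine (Types.FilteredColimit.colimit_eq_iff _).trans ⟨?_, ?_⟩
  · rintro ⟨j, a, b, h⟩
    exact ⟨j.unop, a.unop, b.unop, shrinkYonedaObjObjEquiv.symm.injective
      ((map_symm _ _).symm.trans (h.trans (map_symm _ _)))⟩
  · rintro ⟨j, a, b, h⟩
    exact ⟨op j, a.op, b.op,
      (map_symm _ _).trans ((congrArg _ h).trans (map_symm _ _).symm)⟩

theorem germ_map_comp [IsCofiltered K] {k l : K} {X : C} (a : l ⟶ k) (u : U.obj k ⟶ X) :
    (germ (U.map a ≫ u) : (proRep.{w} U).obj X) = germ u :=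
  (germ_eq_germ_iff _ _).2 ⟨l, 𝟙 l, a, by simp⟩

theorem isLambdaConnected_elements [IsCofiltered K] :
    IsLambdaConnected (proRep.{w} U).Elements := by
  rintro ⟨X, x⟩ ⟨Y, y⟩
  obtain ⟨k, u, rfl⟩ := exists_germ_eq x
  obtain ⟨l, v, rfl⟩ := exists_germ_eq y
  obtain ⟨j, a, b, -⟩ := IsCofilteredOrEmpty.cone_objs k l
  have germ_id {i : K} {Z : C} (c : j ⟶ i) (t : U.obj i ⟶ Z) :
      (proRep.{w} U).map (U.map c ≫ t) (germ (𝟙 (U.obj j))) = germ t := by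
    rw [map_germ, Category.id_comp, germ_map_comp]
  exact ⟨⟨U.obj j, germ (𝟙 _)⟩, ⟨U.map a ≫ u, germ_id a u⟩, ⟨U.map b ≫ v, germ_id b v⟩⟩

theorem injective_eval [IsCofiltered K] (hepi : ∀ {X Y : C} (f : X ⟶ Y), Epi f) {X : C}
    (x : (proRep.{w} U).obj X) (Y : C) :
    Function.Injective fun f : X ⟶ Y => (proRep.{w} U).map f x := by
  intro f g hfg
  obtain ⟨k, u, rfl⟩ := exists_germ_eq x
  simp only [map_germ, germ_eq_germ_iff] at hfg
  obtain ⟨j, a, b, h⟩ := hfg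
  obtain ⟨i, c, hc⟩ := IsCofilteredOrEmpty.cone_maps a b
  have := hepi (U.map (c ≫ a) ≫ u)
  rw [← cancel_epi (U.map (c ≫ a) ≫ u)]
  calc (U.map (c ≫ a) ≫ u) ≫ f = U.map c ≫ U.map a ≫ u ≫ f := by simp
    _ = U.map c ≫ U.map b ≫ u ≫ g := by rw [h]
    _ = (U.map (c ≫ a) ≫ u) ≫ g := by simp [hc]

end proRep

theorem IsBSite.isFiberFunctor_proRep {J : GrothendieckTopology C} (hJ : IsBSite J)
    [IsCofiltered K] (U : K ⥤ C)
    (hU : ∀ {k l : K} (a : k ⟶ l), coverMor J (U.map a))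
    (hcover : ∀ X : C, ∃ (k : K) (u : U.obj k ⟶ X), coverMor J u)
    (hlift : ∀ {k : K} {X Y : C} (u : U.obj k ⟶ X) (f : Y ⟶ X), coverMor J f →
      ∃ (j : K) (a : j ⟶ k) (v : U.obj j ⟶ Y), v ≫ f = U.map a ≫ u) :
    IsFiberFunctor J (proRep.{w} U) where
  isLambdaConnected := proRep.isLambdaConnected_elements
  injective_eval := proRep.injective_eval hJ.epi
  surjective_map {X Y} f hf x := by
    obtain ⟨k, u, rfl⟩ := proRep.exists_germ_eq x
    obtain ⟨j, a, v, h⟩ := hlift u f hf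
    exact ⟨proRep.germ v, by rw [proRep.map_germ, h, proRep.germ_map_comp]⟩
  exists_edge X := by
    obtain ⟨k, u, hu⟩ := hcover X
    refine ⟨proRep.germ u, ?_⟩
    rintro Y f ⟨y, hy⟩
    obtain ⟨l, v, rfl⟩ := proRep.exists_germ_eq y
    rw [proRep.map_germ, proRep.germ_eq_germ_iff] at hy
    obtain ⟨j, a, b, h⟩ := hy
    have hbu : coverMor J (U.map b ≫ u) := (coverMor J).comp_mem _ _ (hU b) hu
    rw [← h, ← Category.assoc, hJ.comp_iff] at hbu
    exact hbu.1

end ProRepresentable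

section NormalTowers

variable {D : Type*} [Category D]

/-- The endomorphisms of `Y` act transitively on the morphisms from any given object to `Y`. In
`𝒞(𝒯(J))_{/X₀}` every Galois covering of `X₀` has this property. -/
def IsNormalObj (Y : D) : Prop :=
  ∀ ⦃W : D⦄ (s t : W ⟶ Y), ∃ σ : Y ⟶ Y, t ≫ σ = s

theorem IsNormalObj.exists_comp_eq {W X Y : D} (hY : IsNormalObj Y) (h : Nonempty (X ⟶ Y))
    (p : W ⟶ X) (q : W ⟶ Y) : ∃ g : X ⟶ Y, p ≫ g = q := by
  obtain ⟨f⟩ := h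
  obtain ⟨σ, hσ⟩ := hY q (p ≫ f)
  exact ⟨f ≫ σ, by rw [← Category.assoc, hσ]⟩

theorem IsNormalObj.exists_lift (hepi : ∀ {X Y : D} (f : X ⟶ Y), Epi f)
    (hore : RightOreCondition D) {N A B : D} (hN : IsNormalObj N)
    (s : N ⟶ A) (f : A ⟶ B) (b : N ⟶ B) : ∃ a : N ⟶ A, a ≫ f = b := by
  obtain ⟨W, p, q, hpq⟩ := hore (s ≫ f) b
  obtain ⟨σ, hσ⟩ := hN p q
  have := hepi q
  refine ⟨σ ≫ s, ?_⟩
  rw [← cancel_epi q, ← hpq, ← hσ]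
  simp only [Category.assoc]

/-- A diagram of normal objects that is weakly initial: each object of `D` receives a morphism
from one of its terms. -/
structure IsNormalTower {K : Type*} [Category K] (F : K ⥤ D) : Prop where
  isNormalObj : ∀ k, IsNormalObj (F.obj k)
  exists_hom : ∀ Y : D, ∃ k, Nonempty (F.obj k ⟶ Y)

theorem IsNormalTower.exists_lift (hepi : ∀ {X Y : D} (f : X ⟶ Y), Epi f)
    (hore : RightOreCondition D) {K : Type*} [Category K] [IsCofiltered K]
    {F : K ⥤ D} (hF : IsNormalTower F) {k : K} {B : D} (f : B ⟶ F.obj k) :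
    ∃ (j : K) (a : j ⟶ k) (s : F.obj j ⟶ B), s ≫ f = F.map a := by
  obtain ⟨l, ⟨t⟩⟩ := hF.exists_hom B
  obtain ⟨j, a, b, -⟩ := IsCofilteredOrEmpty.cone_objs k l
  obtain ⟨s, hs⟩ := (hF.isNormalObj j).exists_lift hepi hore (F.map b ≫ t) f (F.map a)
  exact ⟨j, a, s, hs⟩

theorem IsLambdaConnected.exists_hom_finset (hD : IsLambdaConnected D) [Nonempty D]
    {α : Type*} (N : α → D) (s : Finset α) : ∃ Z : D, ∀ a ∈ s, Nonempty (Z ⟶ N a) := by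
  classical
  induction s using Finset.induction_on with
  | empty => exact ⟨Classical.arbitrary D, by simp⟩
  | insert a s _ ih =>
    obtain ⟨Z, hZ⟩ := ih
    obtain ⟨Z', ⟨f⟩, ⟨g⟩⟩ := hD Z (N a)
    refine ⟨Z', fun b hb => ?_⟩
    rcases Finset.mem_insert.1 hb with rfl | hb
    · exact ⟨g⟩
    · exact (hZ b hb).map (f ≫ ·)

section CompatibleHoms

variable [Nonempty D] {S : Type*} {N : S → D}

/- Normality lets all the morphisms be chosen to commute with fixed morphisms from a common
object. -/
theorem exists_compatible_homs_finset (hepi : ∀ {X Y : D} (f : X ⟶ Y), Epi f)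
    (hD : IsLambdaConnected D) (hN : ∀ i, IsNormalObj (N i)) (t : Finset S) :
    ∃ χ : ∀ i j, Nonempty (N i ⟶ N j) → (N i ⟶ N j), ∀ i ∈ t, ∀ j ∈ t, ∀ k ∈ t,
      ∀ hij hjk hik, χ i j hij ≫ χ j k hjk = χ i k hik := by
  obtain ⟨Z, hZ⟩ := hD.exists_hom_finset N t
  have hχ : ∀ i j, Nonempty (N i ⟶ N j) →
      ∃ g : N i ⟶ N j, ∀ (hi : i ∈ t) (hj : j ∈ t), (hZ i hi).some ≫ g = (hZ j hj).some := by
    intro i j h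
    by_cases hij : i ∈ t ∧ j ∈ t
    · obtain ⟨g, hg⟩ := (hN j).exists_comp_eq h (hZ i hij.1).some (hZ j hij.2).some
      exact ⟨g, fun _ _ => hg⟩
    · exact ⟨h.some, fun hi hj => absurd ⟨hi, hj⟩ hij⟩
  choose χ hχ using hχ
  refine ⟨χ, fun i hi j hj k hk hij hjk hik => ?_⟩
  have := hepi (hZ i hi).some
  rw [← cancel_epi (hZ i hi).some, ← Category.assoc, hχ i j hij hi hj, hχ j k hjk hj hk,
    hχ i k hik hi hk]

/- The hom-sets being finite, Rado's selection lemma glues the choices made on finite sets of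
indices. -/
theorem exists_compatible_homs (hepi : ∀ {X Y : D} (f : X ⟶ Y), Epi f)
    (hD : IsLambdaConnected D) (hfin : CardinalityOne D) (hN : ∀ i, IsNormalObj (N i)) :
    ∃ χ : ∀ i j, Nonempty (N i ⟶ N j) → (N i ⟶ N j),
      ∀ i j k hij hjk hik, χ i j hij ≫ χ j k hjk = χ i k hik := by
  classical
  choose g hg using exists_compatible_homs_finset hepi hD hN
  let A := {p : S × S // Nonempty (N p.1 ⟶ N p.2)}
  have (a : A) : Finite (N a.1.1 ⟶ N a.1.2) := hfin _ _
  let ends (t : Finset A) : Finset S := t.image (·.1.1) ∪ t.image (·.1.2)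
  have fst_mem {t : Finset A} {a : A} (ha : a ∈ t) : a.1.1 ∈ ends t :=
    Finset.mem_union_left _ (Finset.mem_image_of_mem _ ha)
  have snd_mem {t : Finset A} {a : A} (ha : a ∈ t) : a.1.2 ∈ ends t :=
    Finset.mem_union_right _ (Finset.mem_image_of_mem (fun b : A => b.1.2) ha)
  obtain ⟨χ, hχ⟩ := Finset.rado_selection (β := fun a : A => (N a.1.1 ⟶ N a.1.2))
    fun t a => g (ends t) a.1.1 a.1.2 a.2
  refine ⟨fun i j h => χ ⟨(i, j), h⟩, fun i j k hij hjk hik => ?_⟩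
  obtain ⟨t, hst, ht⟩ := hχ {⟨(i, j), hij⟩, ⟨(j, k), hjk⟩, ⟨(i, k), hik⟩}
  dsimp only
  rw [ht ⟨(i, j), hij⟩ (by simp), ht ⟨(j, k), hjk⟩ (by simp), ht ⟨(i, k), hik⟩ (by simp)]
  have hijt : (⟨(i, j), hij⟩ : A) ∈ t := hst (by simp)
  have hjkt : (⟨(j, k), hjk⟩ : A) ∈ t := hst (by simp)
  exact hg _ i (fst_mem hijt) j (snd_mem hijt) k (snd_mem hjkt) _ _ _

theorem exists_preorder_isNormalTower (hepi : ∀ {X Y : D} (f : X ⟶ Y), Epi f)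
    (hD : IsLambdaConnected D) (hfin : CardinalityOne D) (hN : ∀ i, IsNormalObj (N i))
    (hweak : ∀ Y : D, ∃ i, Nonempty (N i ⟶ Y)) :
    ∃ (_ : Preorder S) (_ : IsCofiltered S) (F : S ⥤ D), IsNormalTower F := by
  obtain ⟨χ, hχ⟩ := exists_compatible_homs hepi hD hfin hN
  let _ : Preorder S :=
    { le := fun i j => Nonempty (N i ⟶ N j)
      le_refl := fun i => ⟨𝟙 _⟩
      le_trans := fun i j k ⟨f⟩ ⟨g⟩ => ⟨f ≫ g⟩ }
  have : Nonempty S := (hweak (Classical.arbitrary D)).nonempty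
  have : IsCodirectedOrder S := ⟨fun i j => by
    obtain ⟨Y, ⟨f⟩, ⟨g⟩⟩ := hD (N i) (N j)
    obtain ⟨k, ⟨h⟩⟩ := hweak Y
    exact ⟨k, ⟨h ≫ f⟩, ⟨h ≫ g⟩⟩⟩
  let F : S ⥤ D :=
    { obj := N
      map := fun {i j} f => χ i j (leOfHom f)
      map_id := fun i => by
        have := hepi (χ i i ⟨𝟙 _⟩)
        rw [← cancel_epi (χ i i ⟨𝟙 _⟩), Category.comp_id, hχ]
      map_comp := fun f g => (hχ _ _ _ _ _ _).symm }
  exact ⟨inferInstance, inferInstance, F, hN, hweak⟩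

end CompatibleHoms

theorem exists_isNormalTower_of_cardinalityOne [Nonempty D] [EssentiallySmall.{w} D]
    (hepi : ∀ {X Y : D} (f : X ⟶ Y), Epi f) (hD : IsLambdaConnected D) (hfin : CardinalityOne D)
    (hnormal : ∀ Y : D, ∃ Z : D, IsNormalObj Z ∧ Nonempty (Z ⟶ Y)) :
    ∃ (K : Type w) (_ : Preorder K) (_ : IsCofiltered K) (F : K ⥤ D), IsNormalTower F := by
  choose Z hZ hZhom using hnormal
  let e := equivSmallModel.{w} D
  refine ⟨SmallModel.{w} D, exists_preorder_isNormalTower hepi hD hfin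
    (N := fun i => Z (e.inverse.obj i)) (fun _ => hZ _) fun Y => ?_⟩
  exact ⟨e.functor.obj Y, (hZhom _).map (· ≫ e.unitInv.app Y)⟩

theorem exists_isNormalTower_of_cardinalityTwo [Nonempty D] (hD : IsLambdaConnected D)
    (hcount : CardinalityTwo D) (hnormal : ∀ Y : D, ∃ Z : D, IsNormalObj Z ∧ Nonempty (Z ⟶ Y)) :
    ∃ F : ℕᵒᵖ ⥤ D, IsNormalTower F := by
  obtain ⟨T, hT, hTweak⟩ := hcount
  obtain ⟨Y₀, hY₀, -⟩ := hTweak (Classical.arbitrary D)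
  obtain ⟨s, rfl⟩ := hT.exists_eq_range ⟨Y₀, hY₀⟩
  have step (Y Y' : D) : ∃ Z : D, IsNormalObj Z ∧ Nonempty (Z ⟶ Y) ∧ Nonempty (Z ⟶ Y') := by
    obtain ⟨W, ⟨f⟩, ⟨g⟩⟩ := hD Y Y'
    obtain ⟨Z, hZ, ⟨h⟩⟩ := hnormal W
    exact ⟨Z, hZ, ⟨h ≫ f⟩, ⟨h ≫ g⟩⟩
  choose Z hZ hZ₁ hZ₂ using step
  let X : ℕ → D := fun n => Nat.rec (Z (s 0) (s 0)) (fun n Y => Z Y (s (n + 1))) n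
  refine ⟨Functor.ofOpSequence (X := X) fun n => (hZ₁ (X n) (s (n + 1))).some, ?_, fun Y => ?_⟩
  · rintro ⟨_ | n⟩ <;> exact hZ _ _
  · obtain ⟨_, ⟨n, rfl⟩, ⟨f⟩⟩ := hTweak Y
    have hXs : Nonempty (X n ⟶ s n) := by cases n <;> exact hZ₂ _ _
    exact ⟨.op n, hXs.map (· ≫ f)⟩

end NormalTowers

section Overcategories

variable {D : Type*} [Category D]

theorem isLambdaConnected_over (hore : RightOreCondition D) (X : D) :
    IsLambdaConnected (Over X) := fun A B => by
  obtain ⟨W, p, q, h⟩ := hore A.hom B.hom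
  exact ⟨Over.mk (p ≫ A.hom), ⟨Over.homMk p⟩, ⟨Over.homMk q h.symm⟩⟩

theorem rightOreCondition_over (hore : RightOreCondition D) (X : D) :
    RightOreCondition (Over X) := fun {A B B'} f g => by
  obtain ⟨W, p, q, h⟩ := hore f.left g.left
  refine ⟨Over.mk (p ≫ B.hom), Over.homMk p, Over.homMk q ?_, Over.OverMorphism.ext h⟩
  rw [← Over.w g, ← Category.assoc, ← h, Category.assoc, Over.w f]
  rfl

instance essentiallySmall_wideSubcategory [EssentiallySmall.{w} D] (P : MorphismProperty D)
    [P.IsMultiplicative] [P.RespectsIso] : EssentiallySmall.{w} (WideSubcategory P) := by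
  have := locallySmall_of_faithful.{w} (wideSubcategoryInclusion P)
  rw [essentiallySmall_iff_objectPropertyEssentiallySmall_top]
  obtain ⟨Q, _, hQ⟩ := ObjectProperty.EssentiallySmall.exists_small_le'.{w} (⊤ : ObjectProperty D)
  refine ⟨fun X => Q X.obj, ?_, fun X _ => ?_⟩
  · exact small_of_surjective.{w} (α := Subtype Q) (f := fun X => ⟨⟨X.1⟩, X.2⟩)
      fun X => ⟨⟨X.1.obj, X.2⟩, rfl⟩
  · obtain ⟨Y, hY, ⟨e⟩⟩ := hQ X.obj trivial
    exact ⟨⟨Y⟩, hY, ⟨WideSubcategory.isoMk e (P.of_isIso _) (P.of_isIso _)⟩⟩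

instance essentiallySmall_over [EssentiallySmall.{w} D] (X : D) : EssentiallySmall.{w} (Over X) :=
  CostructuredArrow.essentiallySmall

end Overcategories

section CoverCategory

variable {C : Type u} [Category.{v} C] {J : GrothendieckTopology C} {X₀ : CoverCat J}

theorem IsATopology.exists_coverMor_comp_eq (hJ : IsATopology J) {X Y₁ Y₂ : C} (f₁ : Y₁ ⟶ X)
    (f₂ : Y₂ ⟶ X) (hf₁ : coverMor J f₁) :
    ∃ (Z : C) (g₁ : Z ⟶ Y₁) (g₂ : Z ⟶ Y₂), coverMor J g₂ ∧ g₁ ≫ f₁ = g₂ ≫ f₂ := by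
  obtain ⟨T, -, hT⟩ := hJ
  have h := J.pullback_stable f₂ hf₁
  rw [hT] at h
  obtain ⟨Z, g₂, ⟨_, g₁, _, ⟨⟩, hg⟩, hg₂⟩ := h
  refine ⟨Z, g₁, g₂, ?_, hg⟩
  change _ ∈ J _
  rw [hT]
  exact ⟨Z, g₂, Sieve.le_generate _ _ _ (Presieve.singleton_self _), hg₂⟩

theorem galoisCovering.exists_iso_comp_eq {X Y Z : C} {f : Y ⟶ X} (hf : galoisCovering C f)
    (s t : Z ⟶ Y) (h : s ≫ f = t ≫ f) : ∃ σ : Y ≅ Y, σ.hom ≫ f = f ∧ t ≫ σ.hom = s := by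
  obtain ⟨G, _, ρ, hρ⟩ := hf
  let _ := homAction ρ Z
  obtain ⟨g, hg⟩ := (hρ Z).orbit s t h
  exact ⟨(Over.forget X).mapIso (ρ g), Over.w (ρ g).hom, hg⟩

theorem isNormalObj_of_galoisCovering {A : Over X₀} (hA : galoisCovering C A.hom.hom) :
    IsNormalObj A := fun W s t => by
  have hw (r : W ⟶ A) : r.left.hom ≫ A.hom.hom = W.hom.hom :=
    congrArg (fun φ => φ.hom) (Over.w r)
  obtain ⟨σ, hσ, h⟩ := hA.exists_iso_comp_eq s.left.hom t.left.hom ((hw s).trans (hw t).symm)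
  exact ⟨Over.homMk ⟨σ.hom, (coverMor J).of_isIso _⟩ (WideSubcategory.hom_ext _ hσ),
    Over.OverMorphism.ext (WideSubcategory.hom_ext _ h)⟩

namespace IsBSite

theorem rightOreCondition_coverCat (hJ : IsBSite J) :
    RightOreCondition (CoverCat J) := fun f g => by
  obtain ⟨W, p, q, hq, h⟩ := hJ.aTopology.exists_coverMor_comp_eq f.hom g.hom f.property
  have hp : coverMor J (p ≫ f.hom) := h ▸ (coverMor J).comp_mem _ _ hq g.property
  exact ⟨⟨W⟩, ⟨p, ((hJ.comp_iff _ _).1 hp).2⟩, ⟨q, hq⟩, WideSubcategory.hom_ext _ h⟩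

theorem epi_over (hJ : IsBSite J) {A B : Over X₀} (f : A ⟶ B) : Epi f :=
  have : Epi f.left.hom := hJ.epi _
  have : Epi f.left := (wideSubcategoryInclusion (coverMor J)).epi_of_epi_map this
  Over.epi_of_epi_left f

theorem exists_isNormalObj (hJ : IsBSite J) (hgal : HasEnoughGalois (coverMor J)) (A : Over X₀) :
    ∃ Z : Over X₀, IsNormalObj Z ∧ Nonempty (Z ⟶ A) := by
  have hA : hat (coverMor J) A.hom.hom :=
    ⟨_, 𝟙 _, by simpa only [Category.id_comp] using A.hom.property⟩
  rw [← hgal] at hA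
  obtain ⟨Z, g, hg, hZ⟩ := hA
  let p : (⟨Z⟩ : CoverCat J) ⟶ A.left := ⟨g, ((hJ.comp_iff _ _).1 hg).2⟩
  exact ⟨Over.mk (p ≫ A.hom), isNormalObj_of_galoisCovering hZ, ⟨Over.homMk p⟩⟩

end IsBSite

theorem IsYSite.exists_isGrid_of_isNormalTower (hJ : IsYSite.{w} J) {K : Type*} [Category K]
    [IsCofiltered K] [Small.{w} K] {F : K ⥤ Over X₀} (hF : IsNormalTower F) :
    ∃ (P : Type w) (_ : PartialOrder P) (ι : P ⥤ C), IsGrid J ι := by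
  have := hJ.essentiallySmall
  have hore : RightOreCondition (Over X₀) :=
    rightOreCondition_over hJ.rightOreCondition_coverCat X₀
  let U : K ⥤ C := F ⋙ Over.forget X₀ ⋙ wideSubcategoryInclusion (coverMor J)
  refine (hJ.isFiberFunctor_proRep U (fun a => (F.map a).left.property) (fun X => ?_)
    fun {k X Y} u f hf => ?_).exists_isGrid
  · obtain ⟨Z, ⟨p⟩, ⟨q⟩⟩ := hJ.lambdaConnected ⟨X⟩ X₀
    obtain ⟨k, ⟨r⟩⟩ := hF.exists_hom (Over.mk q)
    exact ⟨k, (r.left ≫ p).hom, (r.left ≫ p).property⟩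
  · obtain ⟨W, g, h, hh, hgh⟩ := hJ.aTopology.exists_coverMor_comp_eq f u hf
    let h' : (⟨W⟩ : CoverCat J) ⟶ (F.obj k).left := ⟨h, hh⟩
    obtain ⟨j, a, s, hs⟩ := hF.exists_lift hJ.epi_over hore
      (Over.homMk h' : Over.mk (h' ≫ (F.obj k).hom) ⟶ F.obj k)
    obtain ⟨t, ht⟩ : ∃ t : U.obj j ⟶ W, t ≫ h = U.map a :=
      ⟨s.left.hom, congrArg (fun φ => φ.left.hom) hs⟩
    exact ⟨j, a, t ≫ g, by rw [Category.assoc, hgh, ← ht, Category.assoc]⟩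

end CoverCategory

end YSite

theorem proposition6p2 {C : Type u} [Category.{v} C] (J : GrothendieckTopology C)
    (hJ : YSite.IsYSite.{w} J)
    (hX₀ : ∃ X₀ : YSite.CoverCat J,
      YSite.CardinalityOne (Over X₀) ∨ YSite.CardinalityTwo (Over X₀)) :
    ∃ (P : Type w) (_ : PartialOrder P) (ι : P ⥤ C), YSite.IsGrid J ι := by
  obtain ⟨X₀, hcard⟩ := hX₀
  have := hJ.essentiallySmall
  have : Nonempty (Over X₀) := ⟨Over.mk (𝟙 X₀)⟩
  have hΛ := YSite.isLambdaConnected_over hJ.rightOreCondition_coverCat X₀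
  have hnormal := hJ.exists_isNormalObj (X₀ := X₀) hJ.enoughGalois
  rcases hcard with hfin | hcount
  · obtain ⟨K, _, _, F, hF⟩ :=
      YSite.exists_isNormalTower_of_cardinalityOne.{w} hJ.epi_over hΛ hfin hnormal
    exact hJ.exists_isGrid_of_isNormalTower hF
  · obtain ⟨F, hF⟩ := YSite.exists_isNormalTower_of_cardinalityTwo hΛ hcount hnormal
    exact hJ.exists_isGrid_of_isNormalTower hF
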